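/- Let $n,t\ge 1$ be integers, let $\mathbb R[X]=\mathbb R[X_1,\dots,X_n]$, and let $M_t(\mathbb R[X])$ be the algebra of $t\times t$ matrices with entries in $\mathbb R[X]$. A matrix-valued measure on $\mathbb R^n$ is a family $\mathbf E=(\sigma_{ij})_{i,j=1}^t$ of finite signed Borel measures on $\mathbb R^n$, with $\mathbf E(A)=(\sigma_{ij}(A))_{i,j}$ for Borel sets $A$; its support is $\operatorname{supp}\mathbf E=\bigcup_{i,j}\operatorname{supp}\sigma_{ij}$, where $\operatorname{supp}\sigma_{ij}$ is the support of the total variation measure of $\sigma_{ij}$. It is called positive semidefinite if $\sigma_{ij}=\sigma_{ji}$ for all $i,j$ and $v^T\mathbf E(A)v\ge 0$ for every Borel set $A$ and every $v\in\mathbb R^t$. For a closed set $K\subseteq\mathbb R^n$, a linear functional $\mathcal L:M_t(\mathbb R[X])\to\mathbb R$ is called a tracial $K$-moment functional if there is a positive semidefinite matrix-valued measure $\mathbf E=(\sigma_{ij})$ on $\mathbb R^n$ with $\operatorname{supp}\mathbf E\subseteq K$ such that, for every $\mathbf F=(F_{ij})\in M_t(\mathbb R[X])$, each $F_{ij}$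 is integrable with respect to $\sigma_{ji}$ and $$\mathcal L(\mathbf F)=\int \operatorname{tr}\big(\mathbf F(x)\,d\mathbf E(x)\big)=\sum_{i,j=1}^t\int F_{ij}(x)\,d\sigma_{ji}(x).$$ A matrix $\mathbf G\in M_t(\mathbb R)$, not assumed to be symmetric, is called positive definite if $v^T\mathbf G v>0$ for all $v\in\mathbb R^t\setminus\{0\}$. Put $l_{2i-1}=1+X_i$ and $l_{2i}=1-X_i$ for $i=1,\dots,n$. Let $\mathcal L$ be a real-valued linear functional on $M_t(\mathbb R[X])$. Then the following are equivalent. 1. $\mathcal L$ is a tracial $[-1,1]^n$-moment functional. 2. $\mathcal L\big(l_1^{\alpha_1}l_2^{\alpha_2}\cdots l_{2n-1}^{\alpha_{2n-1}}l_{2n}^{\alpha_{2n}}\,\mathbf G\big)\ge 0$ for all positive definite matrices $\mathbf G\in M_t(\mathbb R)$ and all $\alpha=(\alpha_1,\dots,\alpha_{2n})\in\mathbb N_0^{2n}$. -/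

import Mathlib

open MeasureTheory

namespace TracialMoment

/-- A `t × t` matrix-valued measure on `ℝⁿ`: a `t × t` family of finite signed Borel measures. -/
abbrev MatrixMeasure (n t : ℕ) : Type :=
  Matrix (Fin t) (Fin t) (SignedMeasure (Fin n → ℝ))

namespace MatrixMeasure

variable {n t : ℕ}

/-- The value `E(A) = (σ_ij(A))` of a matrix-valued measure on a set `A`. -/
noncomputable def value (E : MatrixMeasure n t) (A : Set (Fin n → ℝ)) :
    Matrix (Fin t) (Fin t) ℝ :=
  Matrix.of fun i j => E i j A

/-- A positive semidefinite matrix-valued measure: it is symmetric, and `vᵀ E(A) v ≥ 0` for every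
Borel set `A` and every vector `v`. -/
def IsPosSemidef (E : MatrixMeasure n t) : Prop :=
  (∀ i j, E i j = E j i) ∧
    ∀ A : Set (Fin n → ℝ), MeasurableSet A → ∀ v : Fin t → ℝ,
      0 ≤ dotProduct v ((E.value A).mulVec v)

/-- The support of a matrix-valued measure: the union of the supports of its entries, where the
support of a signed measure is the support of its total variation measure. -/
def supp (E : MatrixMeasure n t) : Set (Fin n → ℝ) :=
  ⋃ i, ⋃ j, (E i j).variation.support

/-- Integrability of a matrix polynomial `F` against `E`: each function `F_ij` is integrable
against the signed measure `E_ji`. -/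
def PolyIntegrable (E : MatrixMeasure n t)
    (F : Matrix (Fin t) (Fin t) (MvPolynomial (Fin n) ℝ)) : Prop :=
  ∀ i j, (E j i).Integrable fun x => MvPolynomial.eval x (F i j)

/-- The integral `∫ tr(F(x) dE(x)) = ∑ᵢ ∑ⱼ ∫ F_ij(x) dE_ji(x)`. -/
noncomputable def traceIntegral (E : MatrixMeasure n t)
    (F : Matrix (Fin t) (Fin t) (MvPolynomial (Fin n) ℝ)) : ℝ :=
  ∑ i, ∑ j, ∫ᵛ x, MvPolynomial.eval x (F i j) ∂<•(E j i)

end MatrixMeasure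

/-- `L` is a tracial `K`-moment functional: it is represented by a positive semidefinite
matrix-valued measure supported in `K`. -/
def IsTracialMomentFunctional {n t : ℕ} (K : Set (Fin n → ℝ))
    (L : Matrix (Fin t) (Fin t) (MvPolynomial (Fin n) ℝ) →ₗ[ℝ] ℝ) : Prop :=
  ∃ E : MatrixMeasure n t, E.IsPosSemidef ∧ E.supp ⊆ K ∧
    ∀ F, E.PolyIntegrable F ∧ L F = E.traceIntegral F

/-- A real square matrix `G` is positive definite if `vᵀ G v > 0` for every nonzero vector `v`.
The matrix is not required to be symmetric (so this is weaker than `Matrix.PosDef`). -/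
def IsPositiveDefinite {t : ℕ} (G : Matrix (Fin t) (Fin t) ℝ) : Prop :=
  ∀ v : Fin t → ℝ, v ≠ 0 → 0 < dotProduct v (G.mulVec v)

/-- The hypercube `[-1,1]ⁿ`. -/
def hypercube (n : ℕ) : Set (Fin n → ℝ) :=
  {x | ∀ i, x i ∈ Set.Icc (-1 : ℝ) 1}

/-- The linear polynomials `1 + X₁, 1 - X₁, …, 1 + Xₙ, 1 - Xₙ`, listed in this order with indices
`0, 1, …, 2n - 1`. -/
noncomputable def boxPoly (n : ℕ) (j : Fin (2 * n)) : MvPolynomial (Fin n) ℝ :=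
  if (j : ℕ) % 2 = 0 then 1 + MvPolynomial.X ⟨(j : ℕ) / 2, by omega⟩
  else 1 - MvPolynomial.X ⟨(j : ℕ) / 2, by omega⟩

/-- A scalar matrix regarded as a constant matrix polynomial. -/
noncomputable def constMatrix (n : ℕ) {t : ℕ} (G : Matrix (Fin t) (Fin t) ℝ) :
    Matrix (Fin t) (Fin t) (MvPolynomial (Fin n) ℝ) :=
  G.map MvPolynomial.C

end TracialMoment

/-! For a fixed constant matrix `G` with nonnegative quadratic form, study the scalar functional p ↦
L(pG). Perturbing `G` to G + ε·1 makes it nonnegative on products of the box polynomials. Bernstein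
approximation extends this to every p nonnegative on the cube (`nonneg_of_nonneg_hypercube`), so a
finite measure on the cube represents it (`exists_measure_of_nonneg`). Taking G = vvᵀ gives measures
μ_v, and polarization of v ↦ μ_v defines the entries of E. An antisymmetric `G` has zero quadratic
form, hence L(pG) = 0 (`slice_eq_zero_of_quadratic_zero`), so L only sees symmetric parts and E
represents all of L. Moments determine measures on a compact set, so vᵀEv = μ_v ≥ 0. Conversely,
L(pG) is the integral of p against the scalar measure tr(G E), which is nonnegative because each
E(A) is a sum of rank-one matrices wwᵀ. -/

namespace TracialMoment

/-! ### Bernstein approximation and positivity on the unit cube -/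

section Bernstein

/-- Every power is a combination of Bernstein basis elements with falling factorial weights. -/
lemma pow_eq_sum_bernstein {A : Type*} [CommRing A] [Algebra ℝ A] (x : A) {j m : ℕ} (h : j ≤ m) :
    x ^ j = ∑ k : Fin (m + 1), ((((k : ℕ).descFactorial j : ℝ) / (m.descFactorial j : ℝ)) *
      (m.choose k : ℝ)) • (x ^ (k : ℕ) * (1 - x) ^ (m - k)) := by
  have hone : x ^ j = x ^ j * (x + (1 - x)) ^ (m - j) := by simp
  rw [hone, add_pow, Finset.mul_sum,
    Fin.sum_univ_eq_sum_range (fun k => (((k.descFactorial j : ℝ) / (m.descFactorial j : ℝ)) *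
      (m.choose k : ℝ)) • (x ^ k * (1 - x) ^ (m - k))) (m + 1)]
  have hm : m + 1 = j + (m - j + 1) := by omega
  -- Terms with k < j vanish since their falling factorial is 0; the rest match the binomial
  -- expansion by C(m,k) C(k,j) = C(m,j) C(m-j,k-j).
  rw [hm, Finset.sum_range_add _ j, Finset.sum_eq_zero (s := Finset.range j), zero_add]
  · refine Finset.sum_congr rfl fun i hi => ?_
    have hi' : i ≤ m - j := by simpa [Nat.lt_succ_iff] using hi
    have hcoef : ((j + i).descFactorial j : ℝ) / (m.descFactorial j : ℝ) * (m.choose (j + i) : ℝ)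
        = ((m - j).choose i : ℝ) := by
      have hne : (m.descFactorial j : ℝ) ≠ 0 := by
        exact_mod_cast (Nat.descFactorial_pos.2 h).ne'
      rw [div_mul_eq_mul_div, div_eq_iff hne]
      have := Nat.choose_mul (n := m) (k := j + i) (s := j) (by omega)
      rw [Nat.add_sub_cancel_left] at this
      rw [Nat.descFactorial_eq_factorial_mul_choose, Nat.descFactorial_eq_factorial_mul_choose]
      have h' : (m.choose (j + i) : ℝ) * ((j + i).choose j : ℝ)
          = (m.choose j : ℝ) * ((m - j).choose i : ℝ) := by exact_mod_cast this
      push_cast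
      linear_combination (j.factorial : ℝ) * h'
    rw [hcoef, Algebra.smul_def, map_natCast, pow_add, Nat.sub_add_eq]
    ring
  · intro k hk
    rw [Nat.descFactorial_of_lt (Finset.mem_range.1 hk)]
    simp

lemma descFactorial_div_mem_Icc {k m : ℕ} (h : k ≤ m) (j : ℕ) :
    ((k.descFactorial j : ℝ) / (m.descFactorial j : ℝ)) ∈ Set.Icc (0 : ℝ) 1 :=
  ⟨by positivity, div_le_one_of_le₀ (by exact_mod_cast Nat.descFactorial_le j h) (by positivity)⟩

lemma abs_mul_sub_mul_le {a a' b b' : ℝ} (hb : |b| ≤ 1) (ha' : |a'| ≤ 1) :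
    |a * b - a' * b'| ≤ |a - a'| + |b - b'| := by
  calc |a * b - a' * b'| = |(a - a') * b + a' * (b - b')| := by ring_nf
    _ ≤ |a - a'| * |b| + |a'| * |b - b'| := by
      simpa only [abs_mul] using abs_add_le ((a - a') * b) (a' * (b - b'))
    _ ≤ |a - a'| * 1 + 1 * |b - b'| := by gcongr
    _ = _ := by ring

lemma abs_prod_sub_prod_le {ι : Type*} (s : Finset ι) (f g : ι → ℝ) (hf : ∀ i, |f i| ≤ 1)
    (hg : ∀ i, |g i| ≤ 1) : |∏ i ∈ s, f i - ∏ i ∈ s, g i| ≤ ∑ i ∈ s, |f i - g i| := by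
  classical
  induction s using Finset.induction_on with
  | empty => simp
  | insert a s ha ih =>
    rw [Finset.prod_insert ha, Finset.prod_insert ha, Finset.sum_insert ha]
    refine (abs_mul_sub_mul_le ?_ (hg a)).trans (by gcongr)
    rw [Finset.abs_prod]
    exact Finset.prod_le_one (fun _ _ => abs_nonneg _) fun i _ => hf i

/-- Falling factorial ratios converge to powers, uniformly in the numerator. -/
lemma exists_abs_descFactorial_div_sub_pow_le (j : ℕ) {ε : ℝ} (hε : 0 < ε) :
    ∃ N : ℕ, ∀ m ≥ N, ∀ k ≤ m,
      |(k.descFactorial j : ℝ) / (m.descFactorial j : ℝ) - ((k : ℝ) / m) ^ j| ≤ ε := by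
  induction j generalizing ε with
  | zero => exact ⟨0, fun m _ k _ => by simp [hε.le]⟩
  | succ j ih =>
    obtain ⟨N, hN⟩ := ih (half_pos hε)
    obtain ⟨M, hM⟩ := exists_nat_gt ((j : ℝ) / (ε / 2))
    -- This makes j ≤ (ε/2)(m - j), which bounds the error of the new factor (k-j)/(m-j) against k/m
    -- by ε/2.
    refine ⟨max N (j + M + 1), fun m hm k hk => ?_⟩
    have hmN : N ≤ m := (le_max_left _ _).trans hm
    have hmM : j + M + 1 ≤ m := (le_max_right _ _).trans hm
    have hmj : (M : ℝ) + 1 ≤ (m : ℝ) - j := by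
      have : ((j + M + 1 : ℕ) : ℝ) ≤ m := by exact_mod_cast hmM
      push_cast at this; linarith
    have hM0 : (0 : ℝ) ≤ M := by positivity
    have hj0 : (0 : ℝ) ≤ j := by positivity
    have hk0 : (0 : ℝ) ≤ k := by positivity
    have hm0 : (0 : ℝ) < m := by linarith
    have hkm : (k : ℝ) ≤ m := by exact_mod_cast hk
    have hjm : (j : ℝ) ≤ ε / 2 * (m - j) := by
      rw [div_lt_iff₀ (half_pos hε)] at hM
      nlinarith
    have hcast : ((m - j : ℕ) : ℝ) = m - j := Nat.cast_sub (by omega)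
    rw [Nat.descFactorial_succ, Nat.descFactorial_succ, Nat.cast_mul, Nat.cast_mul, mul_div_mul_comm,
      mul_comm, pow_succ]
    have hkm1 : (k : ℝ) / m ∈ Set.Icc (0 : ℝ) 1 := ⟨by positivity, div_le_one_of_le₀ hkm hm0.le⟩
    have hq : ((k - j : ℕ) : ℝ) / ((m - j : ℕ) : ℝ) ∈ Set.Icc (0 : ℝ) 1 :=
      ⟨by positivity, div_le_one_of_le₀ (by exact_mod_cast Nat.sub_le_sub_right hk j)
        (by positivity)⟩
    refine (abs_mul_sub_mul_le (abs_le.2 ⟨by linarith [hq.1], hq.2⟩) ?_).trans ?_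
    · rw [abs_of_nonneg (pow_nonneg hkm1.1 _)]
      exact pow_le_one₀ hkm1.1 hkm1.2
    have h2 : |((k - j : ℕ) : ℝ) / ((m - j : ℕ) : ℝ) - (k : ℝ) / m| ≤ ε / 2 := by
      rw [hcast]
      have hpos : (0 : ℝ) < m - j := by linarith
      -- For k ≤ j the truncated difference k - j is 0, and k/m ≤ j/m is already small.
      rcases le_total j k with hjk | hkj
      · rw [Nat.cast_sub hjk]
        have : ((k : ℝ) - j) / (m - j) - k / m = -(j * (m - k) / (m * (m - j))) := by
          field_simp; ring
        rw [this, abs_neg, abs_of_nonneg (by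
          apply div_nonneg (mul_nonneg hj0 (by linarith)); positivity),
          div_le_iff₀ (by positivity)]
        calc (j : ℝ) * (m - k) ≤ j * m := by gcongr; linarith
          _ ≤ (ε / 2 * (m - j)) * m := by gcongr
          _ = _ := by ring
      · rw [Nat.sub_eq_zero_of_le hkj]
        have hkj' : (k : ℝ) ≤ j := by exact_mod_cast hkj
        rw [Nat.cast_zero, zero_div, zero_sub, abs_neg, abs_of_nonneg hkm1.1, div_le_iff₀ hm0]
        nlinarith
    linarith [hN m hmN k hk]

variable {ι : Type*} [Fintype ι]

/-- A linear functional which is nonnegative on the products `∏ yᵢ ^ aᵢ (1 - yᵢ) ^ bᵢ` is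
nonnegative on every polynomial in `y` that is nonnegative on the unit cube. -/
lemma nonneg_aeval_of_nonneg_unitCube {A : Type*} [CommRing A] [Algebra ℝ A] (y : ι → A)
    (Λ : A →ₗ[ℝ] ℝ) (hΛ : ∀ a b : ι → ℕ, 0 ≤ Λ (∏ i, y i ^ a i * (1 - y i) ^ b i))
    (q : MvPolynomial ι ℝ)
    (hq : ∀ x : ι → ℝ, (∀ i, x i ∈ Set.Icc (0 : ℝ) 1) → 0 ≤ MvPolynomial.eval x q) :
    0 ≤ Λ (MvPolynomial.aeval y q) := by
  classical
  have h1 : 0 ≤ Λ 1 := by simpa using hΛ 0 0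
  -- Each monomial has one factor per variable, and each factor will be replaced at cost at most ε;
  -- hence the total error ε S.
  set S : ℝ := ∑ β ∈ q.support, |q.coeff β| * (Fintype.card ι : ℝ) with hS
  have hS0 : 0 ≤ S := Finset.sum_nonneg fun _ _ => by positivity
  suffices H : ∀ ε > 0, -(ε * S * Λ 1) ≤ Λ (MvPolynomial.aeval y q) by
    by_contra hneg
    push Not at hneg
    have := H (-(Λ (MvPolynomial.aeval y q)) / (2 * (S * Λ 1 + 1))) (by
      have := mul_nonneg hS0 h1
      apply div_pos <;> linarith)
    have hp := mul_nonneg hS0 h1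
    have h3 : -(Λ (MvPolynomial.aeval y q)) / (2 * (S * Λ 1 + 1)) * S * Λ 1
        ≤ -(Λ (MvPolynomial.aeval y q)) / 2 := by
      rw [mul_assoc, div_mul_eq_mul_div, div_le_div_iff₀ (by linarith) (by norm_num)]
      nlinarith
    linarith
  intro ε hε
  choose N hN using fun j => exists_abs_descFactorial_div_sub_pow_le j hε
  -- A crude common degree, above every exponent and every threshold in use.
  set m : ℕ := ∑ β ∈ q.support, ∑ i, (N (β i) + β i)
  have hmβ : ∀ β ∈ q.support, ∀ i, N (β i) + β i ≤ m := fun β hβ i =>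
    (Finset.single_le_sum (f := fun i => N (β i) + β i) (fun _ _ => Nat.zero_le _)
      (Finset.mem_univ i)).trans
      (Finset.single_le_sum (f := fun β : ι →₀ ℕ => ∑ i, (N (β i) + β i))
        (fun _ _ => Nat.zero_le _) hβ)
  let c : ℕ → ℕ → ℝ := fun k j => (k.descFactorial j : ℝ) / (m.descFactorial j : ℝ)
  let b : (ι → Fin (m + 1)) → A := fun k =>
    ∏ i, (m.choose (k i) : ℝ) • (y i ^ (k i : ℕ) * (1 - y i) ^ (m - k i))
  have hb : ∀ k, 0 ≤ Λ (b k) := by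
    intro k
    simp only [b]
    rw [Finset.prod_smul, map_smul, smul_eq_mul]
    exact mul_nonneg (by positivity) (hΛ (fun i => k i) fun i => m - k i)
  have hmono : ∀ β : ι →₀ ℕ, (∀ i, β i ≤ m) →
      ∏ i, y i ^ β i = ∑ k : ι → Fin (m + 1), (∏ i, c (k i) (β i)) • b k := by
    intro β hβ
    rw [Finset.prod_congr rfl fun i _ => pow_eq_sum_bernstein (y i) (hβ i), Finset.prod_univ_sum,
      Fintype.piFinset_univ]
    refine Finset.sum_congr rfl fun k _ => ?_
    simp only [b, c]
    rw [← Finset.prod_smul]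
    exact Finset.prod_congr rfl fun i _ => by rw [mul_smul]
  have hq_eq : Λ (MvPolynomial.aeval y q) = ∑ k : ι → Fin (m + 1),
      (∑ β ∈ q.support, q.coeff β * ∏ i, c (k i) (β i)) * Λ (b k) := by
    rw [MvPolynomial.aeval_def, MvPolynomial.eval₂_eq', map_sum]
    simp_rw [Finset.sum_mul]
    rw [Finset.sum_comm]
    refine Finset.sum_congr rfl fun β hβ => ?_
    rw [hmono β fun i => (Nat.le_add_left _ _).trans (hmβ β hβ i), ← Algebra.smul_def, map_smul,
      map_sum, smul_eq_mul, Finset.mul_sum]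
    exact Finset.sum_congr rfl fun k _ => by rw [map_smul, smul_eq_mul, mul_assoc]
  -- Partition of unity: the case β = 0 of `hmono`.
  have hone : Λ 1 = ∑ k : ι → Fin (m + 1), Λ (b k) := by
    have := hmono 0 (by simp)
    simp only [Finsupp.coe_zero, Pi.zero_apply, pow_zero, Finset.prod_const_one, c,
      Nat.descFactorial_zero, Nat.cast_one, div_one, one_smul] at this
    rw [this, map_sum]
  -- Compare coefficients: the one at `b k` is within ε S of q(k/m), which is nonnegative.
  rw [hq_eq, hone, Finset.mul_sum, ← Finset.sum_neg_distrib]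
  refine Finset.sum_le_sum fun k _ => ?_
  rw [← neg_mul]
  refine mul_le_mul_of_nonneg_right ?_ (hb k)
  have hk : ∀ i, (k i : ℕ) ≤ m := fun i => Nat.lt_succ_iff.1 (k i).2
  have hkm : ∀ i, ((k i : ℕ) : ℝ) / m ∈ Set.Icc (0 : ℝ) 1 := fun i =>
    ⟨by positivity, div_le_one_of_le₀ (by exact_mod_cast hk i) (by positivity)⟩
  have hev := hq (fun i => ((k i : ℕ) : ℝ) / m) hkm
  rw [MvPolynomial.eval_eq'] at hev
  have hdiff : |∑ β ∈ q.support, q.coeff β * ∏ i, c (k i) (β i)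
      - ∑ β ∈ q.support, q.coeff β * ∏ i, (((k i : ℕ) : ℝ) / m) ^ β i| ≤ ε * S := by
    rw [← Finset.sum_sub_distrib, hS, Finset.mul_sum]
    refine (Finset.abs_sum_le_sum_abs _ _).trans (Finset.sum_le_sum fun β hβ => ?_)
    rw [← mul_sub, abs_mul, mul_left_comm]
    refine mul_le_mul_of_nonneg_left ?_ (abs_nonneg _)
    refine (abs_prod_sub_prod_le _ _ _ (fun i => ?_) (fun i => ?_)).trans ?_
    · have := descFactorial_div_mem_Icc (hk i) (β i)
      exact abs_le.2 ⟨by linarith [this.1], this.2⟩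
    · rw [abs_of_nonneg (pow_nonneg (hkm i).1 _)]
      exact pow_le_one₀ (hkm i).1 (hkm i).2
    · calc _ ≤ ∑ _i : ι, ε := Finset.sum_le_sum fun i _ =>
            hN (β i) m ((Nat.le_add_right _ _).trans (hmβ β hβ i)) _ (hk i)
        _ = _ := by simp [mul_comm]
  linarith [(abs_le.1 hdiff).1]

end Bernstein

/-! ### Transfer from the unit cube to the hypercube -/

lemma prod_boxPoly_pow (n : ℕ) (a b : Fin n → ℕ) :
    ∏ j : Fin (2 * n), boxPoly n j ^ (if (j : ℕ) % 2 = 0 then a ⟨(j : ℕ) / 2, by omega⟩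
      else b ⟨(j : ℕ) / 2, by omega⟩) =
    ∏ i, ((1 + MvPolynomial.X i) ^ a i * (1 - MvPolynomial.X i : MvPolynomial (Fin n) ℝ) ^ b i) := by
  rw [← (finProdFinEquiv.trans (finCongr (mul_comm n 2))).prod_comp, Fintype.prod_prod_type]
  refine Finset.prod_congr rfl fun i _ => ?_
  rw [Fin.prod_univ_two]
  have h0 : ((finProdFinEquiv.trans (finCongr (mul_comm n 2))) (i, (0 : Fin 2)) : ℕ) = 2 * i := by
    simp
  have h1 : ((finProdFinEquiv.trans (finCongr (mul_comm n 2))) (i, (1 : Fin 2)) : ℕ) =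
      2 * i + 1 := by
    simp [add_comm]
  have e0 : (2 * (i : ℕ)) / 2 = i := by omega
  have e1 : (2 * (i : ℕ) + 1) / 2 = i := by omega
  have e2 : (2 * (i : ℕ) + 1) % 2 = 1 := by omega
  simp only [boxPoly, h0, h1, e0, e1, e2, Nat.mul_mod_right, if_true, one_ne_zero, if_false]

/-- A linear functional which is nonnegative on all products of the `boxPoly`s is nonnegative on
every polynomial that is nonnegative on the hypercube. -/
lemma nonneg_of_nonneg_hypercube {n : ℕ} (Λ : MvPolynomial (Fin n) ℝ →ₗ[ℝ] ℝ)
    (hΛ : ∀ α : Fin (2 * n) → ℕ, 0 ≤ Λ (∏ j, boxPoly n j ^ α j)) (p : MvPolynomial (Fin n) ℝ)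
    (hp : ∀ x ∈ hypercube n, 0 ≤ MvPolynomial.eval x p) : 0 ≤ Λ p := by
  -- The substitution y = (1 + X)/2, 1 - y = (1 - X)/2 turns Bernstein products into positive
  -- multiples of box products.
  let y : Fin n → MvPolynomial (Fin n) ℝ := fun i => (2⁻¹ : ℝ) • (1 + MvPolynomial.X i)
  let q : MvPolynomial (Fin n) ℝ :=
    MvPolynomial.aeval (fun i => (2 : ℝ) • MvPolynomial.X i - 1 : Fin n → MvPolynomial (Fin n) ℝ) p
  have hqp : MvPolynomial.aeval y q = p := by
    have : (MvPolynomial.aeval y).comp (MvPolynomial.aeval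
        (fun i => (2 : ℝ) • MvPolynomial.X i - 1 : Fin n → MvPolynomial (Fin n) ℝ)) =
        AlgHom.id ℝ _ := by
      ext1 i
      simp [y, smul_smul]
    exact DFunLike.congr_fun this p
  rw [← hqp]
  refine nonneg_aeval_of_nonneg_unitCube y Λ (fun a b => ?_) q fun x hx => ?_
  · have hy : ∀ i, 1 - y i = (2⁻¹ : ℝ) • (1 - MvPolynomial.X i) := fun i => by
      have : (1 : MvPolynomial (Fin n) ℝ) = (2⁻¹ : ℝ) • (1 + 1) := by
        rw [← two_smul ℝ (1 : MvPolynomial (Fin n) ℝ), smul_smul]; norm_num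
      simp only [y]
      nth_rw 1 [this]
      rw [← smul_sub]
      congr 1
      ring
    simp only [hy]
    simp only [y, smul_pow, smul_mul_smul_comm]
    rw [Finset.prod_smul, map_smul, smul_eq_mul, ← prod_boxPoly_pow]
    exact mul_nonneg (by positivity) (hΛ _)
  · have : MvPolynomial.eval x q = MvPolynomial.eval (fun i => 2 * x i - 1) p := by
      have : ((MvPolynomial.aeval x).comp (MvPolynomial.aeval
        (fun i => (2 : ℝ) • MvPolynomial.X i - 1 : Fin n → MvPolynomial (Fin n) ℝ))) =
        MvPolynomial.aeval (R := ℝ) (fun i => 2 * x i - 1) := by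
        ext1 i
        simp
      exact DFunLike.congr_fun this p
    rw [this]
    exact hp _ fun i => ⟨by linarith [(hx i).1], by linarith [(hx i).2]⟩

end TracialMoment

/-! ### Moments and measures on compact sets -/

namespace TracialMoment

variable {n : ℕ}

lemma continuous_eval (p : MvPolynomial (Fin n) ℝ) :
    Continuous fun x : Fin n → ℝ => MvPolynomial.eval x p :=
  MvPolynomial.continuous_eval p

lemma integrable_eval_of_isCompact {K : Set (Fin n → ℝ)} (hK : IsCompact K)
    {μ : Measure (Fin n → ℝ)} [IsFiniteMeasure μ] (hμ : μ Kᶜ = 0) (p : MvPolynomial (Fin n) ℝ) :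
    Integrable (fun x => MvPolynomial.eval x p) μ := by
  have h := (continuous_eval p).continuousOn.integrableOn_compact (μ := μ) hK
  rwa [IntegrableOn, Measure.restrict_eq_self_of_ae_mem (show ∀ᵐ x ∂μ, x ∈ K from hμ)] at h

/-- The algebra map sending a polynomial to the continuous function it defines on `K`. -/
noncomputable def polyToContinuousMap (K : Set (Fin n → ℝ)) :
    MvPolynomial (Fin n) ℝ →ₐ[ℝ] C(K, ℝ) :=
  MvPolynomial.aeval fun i => ⟨fun x => (x : Fin n → ℝ) i, (continuous_apply i).comp continuous_subtype_val⟩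

@[simp]
lemma polyToContinuousMap_apply (K : Set (Fin n → ℝ)) (p : MvPolynomial (Fin n) ℝ) (x : K) :
    polyToContinuousMap K p x = MvPolynomial.eval (x : Fin n → ℝ) p := by
  have : (ContinuousMap.evalAlgHom ℝ ℝ x).comp (polyToContinuousMap K) =
      MvPolynomial.aeval (R := ℝ) (x : Fin n → ℝ) := by
    ext1 i
    simp [polyToContinuousMap]
  simpa [MvPolynomial.aeval_eq_eval] using DFunLike.congr_fun this p

/-- A positive linear functional on `C(X, ℝ)`, for `X` compact, is integration against a finite
measure. -/
lemma exists_measure_of_nonneg_continuousMap {X : Type*} [TopologicalSpace X] [CompactSpace X]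
    [T2Space X] [MeasurableSpace X] [BorelSpace X] (g : C(X, ℝ) →ₗ[ℝ] ℝ)
    (hg : ∀ f : C(X, ℝ), (∀ x, 0 ≤ f x) → 0 ≤ g f) :
    ∃ μ : Measure X, IsFiniteMeasure μ ∧ ∀ f : C(X, ℝ), ∫ x, f x ∂μ = g f := by
  let Λ : CompactlySupportedContinuousMap X ℝ →ₚ[ℝ] ℝ :=
  { toFun f := g f.toContinuousMap
    map_add' f f' := map_add g _ _
    map_smul' c f := map_smul g c _
    monotone' f f' hff' := by
      have := hg (f'.toContinuousMap - f.toContinuousMap) fun x => by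
        simpa using! hff' x
      rw [map_sub] at this
      exact sub_nonneg.1 this }
  refine ⟨RealRMK.rieszMeasure Λ, inferInstance, fun f => ?_⟩
  exact RealRMK.integral_rieszMeasure Λ ⟨f, HasCompactSupport.of_compactSpace _⟩

/-- **Haviland's theorem** for compact sets. -/
lemma exists_measure_of_nonneg {K : Set (Fin n → ℝ)} (hK : IsCompact K)
    (Λ : MvPolynomial (Fin n) ℝ →ₗ[ℝ] ℝ)
    (hΛ : ∀ p, (∀ x ∈ K, 0 ≤ MvPolynomial.eval x p) → 0 ≤ Λ p) :
    ∃ μ : Measure (Fin n → ℝ), IsFiniteMeasure μ ∧ μ Kᶜ = 0 ∧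
      ∀ p, ∫ x, MvPolynomial.eval x p ∂μ = Λ p := by
  have : CompactSpace K := isCompact_iff_compactSpace.mp hK
  let φ : MvPolynomial (Fin n) ℝ →ₗ[ℝ] C(K, ℝ) := (polyToContinuousMap K).toLinearMap
  have hφ : ∀ p (x : K), φ p x = MvPolynomial.eval (x : Fin n → ℝ) p :=
    polyToContinuousMap_apply K
  -- If p vanishes on `K`, positivity applies to both p and -p, so Λ descends to polynomial
  -- functions on `K`.
  have hker : LinearMap.ker φ ≤ LinearMap.ker Λ := by
    intro p hp
    have hp0 : ∀ x ∈ K, MvPolynomial.eval x p = 0 := fun x hx => by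
      rw [← hφ p ⟨x, hx⟩, LinearMap.mem_ker.1 hp]; rfl
    have h1 := hΛ p fun x hx => (hp0 x hx).ge
    have h2 := hΛ (-p) fun x hx => by simp [hp0 x hx]
    rw [map_neg] at h2
    exact LinearMap.mem_ker.2 (by linarith)
  let f₀ : LinearMap.range φ →ₗ[ℝ] ℝ :=
    ((LinearMap.ker φ).liftQ Λ hker).comp φ.quotKerEquivRange.symm.toLinearMap
  have hf₀ : ∀ p, f₀ ⟨φ p, LinearMap.mem_range_self φ p⟩ = Λ p := fun p => by
    have : φ.quotKerEquivRange.symm ⟨φ p, LinearMap.mem_range_self φ p⟩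
        = (LinearMap.ker φ).mkQ p := by
      rw [LinearEquiv.symm_apply_eq]; rfl
    simp only [f₀, LinearMap.comp_apply, LinearEquiv.coe_coe, this]
    simp
  let s : PointedCone ℝ C(K, ℝ) :=
  { carrier := {f | ∀ x, 0 ≤ f x}
    zero_mem' := fun x => le_rfl
    add_mem' := fun {f g} hf hg x => add_nonneg (hf x) (hg x)
    smul_mem' := fun c f hf x => mul_nonneg c.2 (hf x) }
  obtain ⟨g, hgf, hgs⟩ := riesz_extension s ⟨LinearMap.range φ, f₀⟩
    (by
      rintro ⟨_, p, rfl⟩ hp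
      change 0 ≤ f₀ ⟨φ p, LinearMap.mem_range_self φ p⟩
      rw [hf₀]
      exact hΛ p fun x hx => by simpa [hφ] using hp ⟨x, hx⟩)
    (by
      intro f
      -- The constant ‖f‖ dominates -f, the cofinality needed for the M. Riesz extension.
      refine ⟨⟨φ (MvPolynomial.C ‖f‖), LinearMap.mem_range_self φ _⟩, fun x => ?_⟩
      have h1 := f.norm_coe_le_norm x
      have h2 : φ (MvPolynomial.C ‖f‖) x = ‖f‖ := by simp [hφ]
      have h3 := neg_abs_le (f x)
      rw [Real.norm_eq_abs] at h1
      change 0 ≤ φ (MvPolynomial.C ‖f‖) x + f x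
      rw [h2]
      linarith)
  obtain ⟨ν, hν, hνg⟩ := exists_measure_of_nonneg_continuousMap g fun f hf => hgs f hf
  refine ⟨ν.map Subtype.val, inferInstance, ?_, fun p => ?_⟩
  · rw [Measure.map_apply (by fun_prop) hK.measurableSet.compl]
    simp
  · rw [integral_map (by fun_prop) (continuous_eval p).aestronglyMeasurable, ← hf₀ p]
    refine Eq.trans ?_ ((hνg _).trans (hgf ⟨φ p, LinearMap.mem_range_self φ p⟩))
    simp [hφ]

/-- Finite measures carried by a compact set are determined by their moments. -/
lemma measure_eq_of_moments_eq {K : Set (Fin n → ℝ)} (hK : IsCompact K)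
    {μ ν : Measure (Fin n → ℝ)} [IsFiniteMeasure μ] [IsFiniteMeasure ν]
    (hμ : μ Kᶜ = 0) (hν : ν Kᶜ = 0)
    (h : ∀ p : MvPolynomial (Fin n) ℝ,
      ∫ x, MvPolynomial.eval x p ∂μ = ∫ x, MvPolynomial.eval x p ∂ν) : μ = ν := by
  have : CompactSpace K := isCompact_iff_compactSpace.mp hK
  have hKm := hK.measurableSet
  have hrestr : ∀ {ρ : Measure (Fin n → ℝ)}, ρ Kᶜ = 0 →
      (ρ.comap (Subtype.val : K → Fin n → ℝ)).map Subtype.val = ρ := fun {ρ} hρ => by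
    rw [map_comap_subtype_coe hKm]
    exact Measure.restrict_eq_self_of_ae_mem hρ
  have hint : ∀ {ρ : Measure (Fin n → ℝ)}, ρ Kᶜ = 0 → ∀ p : MvPolynomial (Fin n) ℝ,
      ∫ x : K, MvPolynomial.eval (x : Fin n → ℝ) p ∂(ρ.comap (Subtype.val : K → Fin n → ℝ))
        = ∫ x, MvPolynomial.eval x p ∂ρ := fun {ρ} hρ p => by
    conv_rhs => rw [← hrestr hρ]
    rw [integral_map (by fun_prop) (continuous_eval p).aestronglyMeasurable]
  rw [← hrestr hμ, ← hrestr hν]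
  congr 1
  -- Polynomial functions form a subalgebra whose coordinates separate points, so Stone–Weierstrass
  -- type uniqueness applies.
  let A : StarSubalgebra ℝ (BoundedContinuousFunction K ℝ) :=
  { carrier := {f | ∃ p : MvPolynomial (Fin n) ℝ, ∀ x : K,
      f x = MvPolynomial.eval (x : Fin n → ℝ) p}
    mul_mem' := by
      rintro f g ⟨p, hp⟩ ⟨q, hq⟩
      exact ⟨p * q, fun x => by simp [hp, hq]⟩
    add_mem' := by
      rintro f g ⟨p, hp⟩ ⟨q, hq⟩
      exact ⟨p + q, fun x => by simp [hp, hq]⟩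
    algebraMap_mem' := fun r => ⟨MvPolynomial.C r, fun x => by simp⟩
    star_mem' := by
      rintro f ⟨p, hp⟩
      exact ⟨p, fun x => by simp [hp]⟩ }
  refine ext_of_forall_mem_subalgebra_integral_eq_of_pseudoEMetric_complete_countable (A := A)
    (fun x y hxy => ?_) ?_
  · obtain ⟨i, hi⟩ : ∃ i, (x : Fin n → ℝ) i ≠ (y : Fin n → ℝ) i := by
      by_contra! hcon
      exact hxy (Subtype.ext (funext hcon))
    let f : C(K, ℝ) := polyToContinuousMap K (MvPolynomial.X i)
    refine ⟨f, ⟨f, ⟨BoundedContinuousFunction.mkOfCompact f, ⟨MvPolynomial.X i, fun z => ?_⟩, rfl⟩,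
      rfl⟩, ?_⟩
    · simp [f]
    · simpa [f] using hi
  · rintro g ⟨p, hp⟩
    simp only [hp]
    rw [hint hμ, hint hν, h]

/-- A signed measure carried by a compact set is zero if all its moments vanish. -/
lemma signedMeasure_eq_zero_of_moments_eq_zero {K : Set (Fin n → ℝ)} (hK : IsCompact K)
    {s : SignedMeasure (Fin n → ℝ)} (hs : s.variation Kᶜ = 0)
    (h : ∀ p : MvPolynomial (Fin n) ℝ, ∫ᵛ x, MvPolynomial.eval x p ∂<•s = 0) : s = 0 := by
  have hdec := s.toSignedMeasure_toJordanDecomposition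
  rw [JordanDecomposition.toSignedMeasure] at hdec
  rw [← SignedMeasure.totalVariation_eq_variation, SignedMeasure.totalVariation,
    Measure.add_apply, add_eq_zero] at hs
  -- The two Jordan parts have equal moments, hence coincide and cancel.
  have heq := measure_eq_of_moments_eq hK hs.1 hs.2 fun p => by
    have hp := h p
    rw [← hdec, VectorMeasure.integral_sub_vectorMeasure
      (by simpa [VectorMeasure.Integrable] using integrable_eval_of_isCompact hK hs.1 p)
      (by simpa [VectorMeasure.Integrable] using integrable_eval_of_isCompact hK hs.2 p),
      VectorMeasure.integral_toSignedMeasure, VectorMeasure.integral_toSignedMeasure] at hp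
    exact sub_eq_zero.1 hp
  rw [← hdec, sub_eq_zero]
  simp only [heq]

end TracialMoment

/-! ### Scalar slices of L and construction of the matrix measure -/

namespace TracialMoment

variable {n t : ℕ}

lemma isCompact_hypercube (n : ℕ) : IsCompact (hypercube n) := by
  have : hypercube n = Set.univ.pi fun _ => Set.Icc (-1 : ℝ) 1 := by
    ext x; simp only [hypercube, Set.mem_ofPred_eq, Set.mem_univ_pi]
  rw [this]
  exact isCompact_univ_pi fun _ => isCompact_Icc

lemma eval_boxPoly_nonneg {x : Fin n → ℝ} (hx : x ∈ hypercube n) (j : Fin (2 * n)) :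
    0 ≤ MvPolynomial.eval x (boxPoly n j) := by
  unfold boxPoly
  split_ifs
  · simpa using by linarith [(hx ⟨(j : ℕ) / 2, by omega⟩).1]
  · simpa using (hx ⟨(j : ℕ) / 2, by omega⟩).2

/-- The bilinear map `(G, p) ↦ L (p G)`. -/
noncomputable def slice (L : Matrix (Fin t) (Fin t) (MvPolynomial (Fin n) ℝ) →ₗ[ℝ] ℝ) :
    Matrix (Fin t) (Fin t) ℝ →ₗ[ℝ] MvPolynomial (Fin n) ℝ →ₗ[ℝ] ℝ :=
  LinearMap.mk₂ ℝ (fun G p => L (p • constMatrix n G))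
    (fun G H p => by
      rw [← map_add, ← smul_add]
      congr 2
      ext1 i j
      simp [constMatrix])
    (fun c G p => by
      rw [← map_smul]
      congr 1
      ext1 i j
      simp [constMatrix, MvPolynomial.smul_eq_C_mul]
      ring)
    (fun G p q => by rw [add_smul, map_add])
    (fun c G p => by rw [smul_assoc, map_smul])

lemma slice_apply (L : Matrix (Fin t) (Fin t) (MvPolynomial (Fin n) ℝ) →ₗ[ℝ] ℝ)
    (G : Matrix (Fin t) (Fin t) ℝ) (p : MvPolynomial (Fin n) ℝ) :
    slice L G p = L (p • constMatrix n G) := rfl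

lemma sum_slice_single (L : Matrix (Fin t) (Fin t) (MvPolynomial (Fin n) ℝ) →ₗ[ℝ] ℝ)
    (F : Matrix (Fin t) (Fin t) (MvPolynomial (Fin n) ℝ)) :
    L F = ∑ i, ∑ j, slice L (Matrix.single i j 1) (F i j) := by
  conv_lhs => rw [Matrix.matrix_eq_sum_single F]
  simp only [map_sum, slice_apply]
  refine Finset.sum_congr rfl fun i _ => Finset.sum_congr rfl fun j _ => ?_
  congr 1
  simp [constMatrix, Matrix.smul_single]

section Positivity

variable {L : Matrix (Fin t) (Fin t) (MvPolynomial (Fin n) ℝ) →ₗ[ℝ] ℝ}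
  (hL : ∀ G : Matrix (Fin t) (Fin t) ℝ, IsPositiveDefinite G →
    ∀ α : Fin (2 * n) → ℕ, 0 ≤ L ((∏ j, boxPoly n j ^ α j) • constMatrix n G))
include hL

/-- G + ε·1 is positive definite for every ε > 0, so the hypothesis passes to the limit ε → 0. -/
lemma slice_nonneg {G : Matrix (Fin t) (Fin t) ℝ}
    (hG : ∀ v : Fin t → ℝ, 0 ≤ dotProduct v (G.mulVec v)) (p : MvPolynomial (Fin n) ℝ)
    (hp : ∀ x ∈ hypercube n, 0 ≤ MvPolynomial.eval x p) : 0 ≤ slice L G p := by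
  refine nonneg_of_nonneg_hypercube _ (fun α => ?_) p hp
  set f := ∏ j, boxPoly n j ^ α j
  have key : ∀ ε : ℝ, 0 < ε → 0 ≤ slice L G f + ε * slice L 1 f := fun ε hε => by
    have hpd : IsPositiveDefinite (G + ε • (1 : Matrix (Fin t) (Fin t) ℝ)) := fun v hv => by
      rw [Matrix.add_mulVec, dotProduct_add, Matrix.smul_mulVec, Matrix.one_mulVec,
        dotProduct_smul, smul_eq_mul]
      have h0 : 0 < dotProduct v v :=
        lt_of_le_of_ne (Finset.sum_nonneg fun i _ => mul_self_nonneg _)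
          fun h => hv (dotProduct_self_eq_zero.1 h.symm)
      linarith [hG v, mul_pos hε h0]
    have := hL _ hpd α
    rw [← slice_apply, map_add, map_smul] at this
    simpa using this
  have hlim : Filter.Tendsto (fun ε : ℝ => slice L G f + ε * slice L 1 f)
      (nhdsWithin 0 (Set.Ioi 0)) (nhds (slice L G f + 0 * slice L 1 f)) :=
    Filter.Tendsto.mono_left (Continuous.tendsto (by fun_prop) 0) nhdsWithin_le_nhds
  rw [zero_mul, add_zero] at hlim
  exact ge_of_tendsto hlim (eventually_nhdsWithin_of_forall key)

lemma exists_measure_slice {G : Matrix (Fin t) (Fin t) ℝ}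
    (hG : ∀ v : Fin t → ℝ, 0 ≤ dotProduct v (G.mulVec v)) :
    ∃ μ : Measure (Fin n → ℝ), IsFiniteMeasure μ ∧ μ (hypercube n)ᶜ = 0 ∧
      ∀ p, ∫ x, MvPolynomial.eval x p ∂μ = slice L G p :=
  exists_measure_of_nonneg (isCompact_hypercube n) _ (slice_nonneg hL hG)

/-- The functional vanishes on polynomial multiples of matrices with zero quadratic form. -/
lemma slice_eq_zero_of_quadratic_zero {G : Matrix (Fin t) (Fin t) ℝ}
    (hG : ∀ v : Fin t → ℝ, dotProduct v (G.mulVec v) = 0) : slice L G = 0 := by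
  obtain ⟨μ, hfin, -, hμ⟩ := exists_measure_slice hL fun v => (hG v).ge
  -- `-G` is admissible too; evaluated at the polynomial 1, this forces the total mass of μ to be 0.
  have h1 := slice_nonneg hL (G := -G) (fun v => by simp [Matrix.neg_mulVec, hG v]) 1
    fun x _ => by simp
  have h2 := hμ 1
  simp only [map_one, integral_const, smul_eq_mul, mul_one] at h2
  rw [map_neg, LinearMap.neg_apply, ← h2] at h1
  have h3 : μ = 0 := by
    rw [← Measure.measure_univ_eq_zero, ← measureReal_eq_zero_iff]
    exact le_antisymm (by linarith) measureReal_nonneg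
  refine LinearMap.ext fun p => ?_
  rw [← hμ p, h3]
  simp

/-- The difference of the two matrix units is antisymmetric. This is where non-symmetric positive
definite `G` in the hypothesis matter. -/
lemma slice_single_comm (i j : Fin t) :
    slice L (Matrix.single i j 1) = slice L (Matrix.single j i 1) := by
  rw [← sub_eq_zero, ← map_sub]
  refine slice_eq_zero_of_quadratic_zero hL fun v => ?_
  have hupd : ∀ a c, Function.update (0 : Fin t → ℝ) a c = Pi.single a c := fun _ _ => rfl
  simp [Matrix.sub_mulVec, Matrix.single_mulVec, hupd, mul_comm]

lemma isTracialMomentFunctional_of_nonneg : IsTracialMomentFunctional (hypercube n) L := by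
  have hK := isCompact_hypercube n
  choose μ hfin hμK hμ using fun v : Fin t → ℝ =>
    exists_measure_slice hL (G := Matrix.vecMulVec v v) fun w => by
      rw [Matrix.vecMulVec_mulVec]
      simp only [dotProduct_smul, MulOpposite.smul_eq_mul_unop, MulOpposite.unop_op]
      rw [dotProduct_comm w v]
      exact mul_self_nonneg _
  let ν : (Fin t → ℝ) → SignedMeasure (Fin n → ℝ) := fun v => (μ v).toSignedMeasure
  have hνi : ∀ v (p : MvPolynomial (Fin n) ℝ),
      (ν v).Integrable fun x => MvPolynomial.eval x p := fun v p => by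
    simpa [ν, VectorMeasure.Integrable] using integrable_eval_of_isCompact hK (hμK v) p
  have hν : ∀ v (p : MvPolynomial (Fin n) ℝ),
      ∫ᵛ x, MvPolynomial.eval x p ∂<•(ν v) = slice L (Matrix.vecMulVec v v) p := fun v p => by
    rw [← hμ v p]
    exact VectorMeasure.integral_toSignedMeasure
  let e : Fin t → Fin t → ℝ := fun i => Pi.single i 1
  -- Polarization: the (i,j) entry of a symmetric form recovered from its quadratic values.
  let E : MatrixMeasure n t := fun i j => (1 / 4 : ℝ) • (ν (e i + e j) - ν (e i - e j))
  have hEi : ∀ i j (p : MvPolynomial (Fin n) ℝ),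
      (E i j).Integrable fun x => MvPolynomial.eval x p := fun i j p =>
    ((hνi _ p).sub_vectorMeasure (hνi _ p)).smul_vectorMeasure _
  have hE : ∀ i j (p : MvPolynomial (Fin n) ℝ),
      ∫ᵛ x, MvPolynomial.eval x p ∂<•(E i j) = slice L (Matrix.single i j 1) p := fun i j p => by
    simp only [E]
    rw [VectorMeasure.integral_smul_vectorMeasure,
      VectorMeasure.integral_sub_vectorMeasure (hνi _ p) (hνi _ p), hν, hν]
    have hpol : Matrix.vecMulVec (e i + e j) (e i + e j) - Matrix.vecMulVec (e i - e j) (e i - e j)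
        = (2 : ℝ) • (Matrix.single i j (1 : ℝ) + Matrix.single j i 1) := by
      have hs : ∀ a b, Matrix.single a b (1 : ℝ) = Matrix.vecMulVec (e a) (e b) := fun a b =>
        (Matrix.single_eq_single_vecMulVec_single a b)
      rw [hs, hs]
      ext a b
      simp [Matrix.vecMulVec_apply]
      ring
    rw [← LinearMap.sub_apply, ← map_sub, hpol, map_smul, map_add, slice_single_comm hL j i]
    simp
    ring
  have hvar : ∀ v, (ν v).variation (hypercube n)ᶜ = 0 := fun v => by
    simpa [ν] using hμK v
  have hEvar : ∀ i j, (E i j).variation (hypercube n)ᶜ = 0 := fun i j => by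
    have h1 : (E i j).variation ≤
        ‖(1 / 4 : ℝ)‖₊ • ((ν (e i + e j)).variation + (ν (e i - e j)).variation) := by
      simp only [E]
      rw [VectorMeasure.variation_smul]
      gcongr
      exact VectorMeasure.variation_sub_le
    have h2 := h1 (hypercube n)ᶜ
    simpa [hvar] using h2
  -- Both sides are carried by the cube and have equal moments; positivity of E then follows from
  -- that of ν v.
  have hquad : ∀ v : Fin t → ℝ, ∑ i, ∑ j, (v i * v j) • E i j = ν v := fun v => by
    rw [← sub_eq_zero]
    have hi2 : ∀ p : MvPolynomial (Fin n) ℝ, ∀ i j,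
        ((v i * v j) • E i j).Integrable fun x => MvPolynomial.eval x p := fun p i j =>
      (hEi i j p).smul_vectorMeasure _
    have hi1 : ∀ p : MvPolynomial (Fin n) ℝ, ∀ i,
        (∑ j, (v i * v j) • E i j).Integrable fun x => MvPolynomial.eval x p := fun p i =>
      VectorMeasure.Integrable.finsetSum_vectorMeasure fun j _ => hi2 p i j
    refine signedMeasure_eq_zero_of_moments_eq_zero hK ?_ fun p => ?_
    · have hsum : ∀ (s : Fin t → SignedMeasure (Fin n → ℝ)),
          (∀ i, (s i).variation (hypercube n)ᶜ = 0) →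
          (∑ i, s i).variation (hypercube n)ᶜ = 0 := fun s hs => by
        have := VectorMeasure.variation_finsetSum_le Finset.univ s (hypercube n)ᶜ
        simpa [hs] using this
      have h1 := (VectorMeasure.variation_sub_le (μ := ∑ i, ∑ j, (v i * v j) • E i j) (ν := ν v))
        (hypercube n)ᶜ
      have h2 := hsum _ fun i => hsum _ fun j => by
        rw [VectorMeasure.variation_smul (μ := E i j) (c := v i * v j)]
        simp [hEvar i j]
      simpa [hvar, h2] using h1
    · rw [VectorMeasure.integral_sub_vectorMeasure
        (VectorMeasure.Integrable.finsetSum_vectorMeasure fun i _ => hi1 p i) (hνi v p),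
        VectorMeasure.integral_finsetSum_vectorMeasure fun i _ => hi1 p i]
      simp_rw [fun i => VectorMeasure.integral_finsetSum_vectorMeasure
        (B := (ContinuousLinearMap.lsmul ℝ ℝ).flip) (s := Finset.univ) fun j _ => hi2 p i j,
        VectorMeasure.integral_smul_vectorMeasure, hE, hν]
      have : Matrix.vecMulVec v v = ∑ i, ∑ j, (v i * v j) • Matrix.single i j (1 : ℝ) := by
        conv_lhs => rw [Matrix.matrix_eq_sum_single (Matrix.vecMulVec v v)]
        simp [Matrix.vecMulVec_apply, Matrix.smul_single]
      rw [this]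
      simp only [map_sum, map_smul, LinearMap.sum_apply, LinearMap.smul_apply, sub_self]
  refine ⟨E, ⟨fun i j => ?_, fun A hA v => ?_⟩, ?_, fun F => ⟨fun i j => hEi j i _, ?_⟩⟩
  · rw [← sub_eq_zero]
    refine signedMeasure_eq_zero_of_moments_eq_zero hK ?_ fun p => ?_
    · have h1 := (VectorMeasure.variation_sub_le (μ := E i j) (ν := E j i)) (hypercube n)ᶜ
      simpa [hEvar] using h1
    · rw [VectorMeasure.integral_sub_vectorMeasure (hEi i j p) (hEi j i p), hE, hE,
        slice_single_comm hL i j, sub_self]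
  · have h1 : dotProduct v ((E.value A).mulVec v) = (ν v) A := by
      rw [← hquad v]
      simp only [dotProduct, Matrix.mulVec, MatrixMeasure.value, Matrix.of_apply]
      simp [Finset.mul_sum]
      refine Finset.sum_congr rfl fun i _ => Finset.sum_congr rfl fun j _ => ?_
      ring
    rw [h1]
    simp only [ν]
    rw [Measure.toSignedMeasure_apply_measurable hA]
    exact measureReal_nonneg
  · exact Set.iUnion_subset fun i => Set.iUnion_subset fun j =>
      Measure.support_subset_of_isClosed hK.isClosed (hEvar i j)
  · rw [sum_slice_single, MatrixMeasure.traceIntegral]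
    refine Finset.sum_congr rfl fun i _ => Finset.sum_congr rfl fun j _ => ?_
    -- The trace pairs F_ij with E_ji, whence the swap of indices.
    rw [hE, slice_single_comm hL]

end Positivity

/-! ### From a representing measure to positivity -/

/-- The trace of the product of a matrix with nonnegative quadratic form and a positive
semidefinite matrix is nonnegative. -/
lemma sum_mul_nonneg_of_posSemidef {G P : Matrix (Fin t) (Fin t) ℝ}
    (hG : ∀ v : Fin t → ℝ, 0 ≤ dotProduct v (G.mulVec v)) (hP : P.PosSemidef) :
    0 ≤ ∑ i, ∑ j, G i j * P j i := by
  obtain ⟨m, w, rfl⟩ := Matrix.posSemidef_iff_eq_sum_vecMulVec.1 hP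
  have : ∑ i, ∑ j, G i j * (∑ k, Matrix.vecMulVec (w k) (star (w k))) j i
      = ∑ k, dotProduct (w k) (G.mulVec (w k)) := by
    simp only [Matrix.sum_apply, Matrix.vecMulVec_apply, star_trivial, dotProduct,
      Matrix.mulVec, Finset.mul_sum]
    rw [Finset.sum_comm (s := Finset.univ (α := Fin m))]
    refine Finset.sum_congr rfl fun i _ => ?_
    rw [Finset.sum_comm]
    refine Finset.sum_congr rfl fun k _ => Finset.sum_congr rfl fun j _ => ?_
    ring
  rw [this]
  exact Finset.sum_nonneg fun k _ => hG _

/-- Integration of a function against a signed measure which is nonnegative on measurable sets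
and carried by a set on which the function is nonnegative. -/
lemma integral_nonneg_of_signedMeasure_nonneg {X : Type*} [MeasurableSpace X]
    {s : SignedMeasure X} (hs : ∀ A, MeasurableSet A → 0 ≤ s A) {K : Set X}
    (hK : MeasurableSet K) (hsK : s Kᶜ = 0) {f : X → ℝ} (hf : ∀ x ∈ K, 0 ≤ f x) :
    0 ≤ ∫ᵛ x, f x ∂<•s := by
  have hle : 0 ≤[Set.univ] s := by
    rw [VectorMeasure.restrict_univ, VectorMeasure.restrict_univ]
    exact fun A hA => by simpa using hs A hA
  rw [← SignedMeasure.toMeasureOfZeroLE_toSignedMeasure s hle,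
    VectorMeasure.integral_toSignedMeasure]
  refine integral_nonneg_of_ae ?_
  have hK' : ∀ᵐ x ∂(s.toMeasureOfZeroLE Set.univ MeasurableSet.univ hle), x ∈ K := by
    rw [ae_iff]
    change (s.toMeasureOfZeroLE Set.univ MeasurableSet.univ hle) Kᶜ = 0
    rw [SignedMeasure.toMeasureOfZeroLE_apply _ _ _ hK.compl]
    simp [hsK]
  filter_upwards [hK'] with x hx using hf x hx

/-- The trace integral of pG is the integral of p against the single signed measure tr(G E),
nonnegative on Borel sets and null off the cube. -/
lemma nonneg_of_isTracialMomentFunctional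
    {L : Matrix (Fin t) (Fin t) (MvPolynomial (Fin n) ℝ) →ₗ[ℝ] ℝ}
    (hL : IsTracialMomentFunctional (hypercube n) L) {G : Matrix (Fin t) (Fin t) ℝ}
    (hG : ∀ v : Fin t → ℝ, 0 ≤ dotProduct v (G.mulVec v)) {p : MvPolynomial (Fin n) ℝ}
    (hp : ∀ x ∈ hypercube n, 0 ≤ MvPolynomial.eval x p) : 0 ≤ L (p • constMatrix n G) := by
  obtain ⟨E, ⟨hsymm, hpos⟩, hsupp, hrep⟩ := hL
  -- Integrability against every entry comes from representing the matrix with all entries p, since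
  -- pG may have zero entries.
  have hint : ∀ i j, (E j i).Integrable fun x => MvPolynomial.eval x p := fun i j =>
    (hrep (Matrix.of fun _ _ => p)).1 i j
  have hint1 : ∀ i, ∀ j ∈ Finset.univ,
      (G i j • E j i).Integrable fun x => MvPolynomial.eval x p :=
    fun i j _ => (hint i j).smul_vectorMeasure _
  have hint2 : ∀ i ∈ Finset.univ,
      (∑ j, G i j • E j i).Integrable fun x => MvPolynomial.eval x p :=
    fun i _ => VectorMeasure.Integrable.finsetSum_vectorMeasure (hint1 i)
  have htrace : L (p • constMatrix n G)
      = ∫ᵛ x, MvPolynomial.eval x p ∂<•(∑ i, ∑ j, G i j • E j i) := by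
    rw [(hrep _).2, VectorMeasure.integral_finsetSum_vectorMeasure hint2,
      MatrixMeasure.traceIntegral]
    refine Finset.sum_congr rfl fun i _ => ?_
    rw [VectorMeasure.integral_finsetSum_vectorMeasure (hint1 i)]
    refine Finset.sum_congr rfl fun j _ => ?_
    rw [VectorMeasure.integral_smul_vectorMeasure, ← VectorMeasure.integral_fun_smul]
    congr 1
    ext x
    simp [constMatrix, mul_comm]
  have happly : ∀ A, (∑ i, ∑ j, G i j • E j i) A = ∑ i, ∑ j, G i j * E.value A j i := fun A => by
    simp [MatrixMeasure.value]
  rw [htrace]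
  refine integral_nonneg_of_signedMeasure_nonneg (fun A hA => ?_)
    (isCompact_hypercube n).measurableSet ?_ hp
  · rw [happly]
    refine sum_mul_nonneg_of_posSemidef hG (Matrix.PosSemidef.of_dotProduct_mulVec_nonneg ?_ ?_)
    · ext i j
      simp [MatrixMeasure.value, hsymm i j]
    · simpa using hpos A hA
  · rw [happly]
    refine Finset.sum_eq_zero fun i _ => Finset.sum_eq_zero fun j _ => ?_
    have h1 : (E j i).variation (hypercube n)ᶜ = 0 :=
      measure_mono_null (Set.compl_subset_compl.2
        ((Set.subset_iUnion₂ (s := fun a b => (E a b).variation.support) j i).trans hsupp))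
        Measure.measure_compl_support
    have h2 := (E j i).enorm_measure_le_variation (hypercube n)ᶜ
    rw [h1, nonpos_iff_eq_zero, enorm_eq_zero] at h2
    simp [MatrixMeasure.value, h2]

end TracialMoment

theorem mainTheorem1 (n t : ℕ)
    (L : Matrix (Fin t) (Fin t) (MvPolynomial (Fin n) ℝ) →ₗ[ℝ] ℝ) :
    TracialMoment.IsTracialMomentFunctional (TracialMoment.hypercube n) L ↔
      ∀ G : Matrix (Fin t) (Fin t) ℝ, TracialMoment.IsPositiveDefinite G →
        ∀ α : Fin (2 * n) → ℕ,
          0 ≤ L ((∏ j, TracialMoment.boxPoly n j ^ α j) • TracialMoment.constMatrix n G) := by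
  refine ⟨fun hL G hG α => ?_, TracialMoment.isTracialMomentFunctional_of_nonneg⟩
  refine TracialMoment.nonneg_of_isTracialMomentFunctional hL (fun v => ?_) fun x hx => ?_
  · rcases eq_or_ne v 0 with rfl | hv
    · simp
    · exact (hG v hv).le
  · rw [map_prod]
    exact Finset.prod_nonneg fun j _ => by
      rw [map_pow]
      exact pow_nonneg (TracialMoment.eval_boxPoly_nonneg hx j) _
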